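/- A nondeterministic one-tape off-line Turing machine $M$ has a finite state set with a start state and disjoint sets of accepting and rejecting states (in which it stops), a finite input alphabet $\Sigma$, and one tape that is infinite to the right only, on which initially the input $x\in\Sigma^*$ is written from the leftmost square on, followed by blanks, with the head on the leftmost square. In each move it nondeterministically chooses, according to its transition relation, a new state, a nonblank symbol from a finite tape alphabet to write on the scanned square, and a move of the head by one square to the left, one to the right, or none (no move leads off the tape). A computation of $M$ on $x$ is accepting if it ends in an accepting state, and the language accepted by $M$ is the set of $x$ that have an accepting computation. For an accepting computation $C$ let $t(C)$ be its number of moves, and let $c(C)$ be the maximum, over all boundaries between two adjacent squares, of the length of the crossing sequence at that boundary, i.e. of the sequence of the states of $M$ at the successive moments at which the head crosses it. For $r\in\{c,t\}$ (the accept measure), let $r(x)=\max\{r(C)\mid C \text{ is an accepting computation on } x\}$ if $x$ is accepted and $r(x)=0$ otherwise, and let $r(n)=\max\{r(x)\mid x\in\Sigma^*,\ |x|=n\}$ (with $r(n)=0$ if there is no such $x$). Whenever $c(n)$ (respectively $t(n)$) is mentioned below, it is assumed that these maxima exist, i.e. that it is finite for every $n$. Theorem. Let $M$ be a nondeterministic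 one-tape off-line Turing machine using crossing sequences of length $c(n)$ and working in time $t(n)$ under the accept measure. Then: (1) $c(n)=o(\log n)$ implies $c(n)=O(1)$; (2) $t(n)=o(n\log n)$ implies $t(n)=O(n)$. Furthermore, $c(n)=O(1)$ if and only if $t(n)=O(n)$, and in this case the language accepted by $M$ is regular. (Statement (1), and the regularity of the language if $c(n)=O(1)$, need only that $c(n)$ is finite for every $n$, and not that $t(n)$ is.) -/

import Mathlib

open Filter Asymptotics

/-- The three possible head moves. -/
inductive HeadMove where
  | left
  | right
  | stay

/-- A nondeterministic one-tape off-line Turing machine with input alphabet `A`, set of states `Q`,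
and set `Γ` of nonblank tape symbols.  A tape symbol is an element of `Option Γ`, where `none` is
the blank; the machine always writes an element of `Γ`, so it never writes the blank. -/
structure OffLineTM (A Γ Q : Type*) where
  /-- the input symbols are among the nonblank tape symbols -/
  embed : A ↪ Γ
  start : Q
  accepting : Set Q
  rejecting : Set Q
  disj : Disjoint accepting rejecting
  /-- the triples (new state, symbol written, head move) allowed for a state and a scanned symbol -/
  trans : Q → Option Γ → Set (Q × Γ × HeadMove)

namespace OffLineTM

/-- A configuration: state, position of the scanned square, and content of the semi-infinite tape,
whose squares are numbered `0, 1, 2, …` from the left. -/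
structure Cfg (Γ Q : Type*) where
  state : Q
  pos : ℕ
  tape : ℕ → Option Γ

/-- `Moves d i j`: the head move `d` leads from square `i` to square `j` (there is no move to the
left from the leftmost square). -/
def Moves : HeadMove → ℕ → ℕ → Prop
  | .left, i, j => i = j + 1
  | .right, i, j => j = i + 1
  | .stay, i, j => j = i

/-- The sequence of states in which the head crosses the boundary between the squares `b` and
`b + 1` in a sequence of configurations. -/
def crossingSeq {Γ Q : Type*} (b : ℕ) : List (Cfg Γ Q) → List Q
  | k :: k' :: l =>
    if (k.pos ≤ b ∧ b < k'.pos) ∨ (k'.pos ≤ b ∧ b < k.pos) then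
      k'.state :: crossingSeq b (k' :: l)
    else crossingSeq b (k' :: l)
  | _ => []

/-- The time of a computation (the list of its configurations): the number of moves. -/
def time {Γ Q : Type*} (C : List (Cfg Γ Q)) : ℕ∞ := (C.tail.length : ℕ∞)

/-- The length of the longest crossing sequence of a computation. -/
noncomputable def crossing {Γ Q : Type*} (C : List (Cfg Γ Q)) : ℕ∞ :=
  ⨆ b : ℕ, ((crossingSeq b C).length : ℕ∞)

variable {A Γ Q : Type*} (M : OffLineTM A Γ Q)

/-- The initial configuration on input `x`. -/
def init (x : List A) : Cfg Γ Q where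
  state := M.start
  pos := 0
  tape i := x[i]?.map M.embed

/-- One move.  The computation stops in accepting and in rejecting states. -/
def Step (k k' : Cfg Γ Q) : Prop :=
  k.state ∉ M.accepting ∧ k.state ∉ M.rejecting ∧
    ∃ s d, (k'.state, s, d) ∈ M.trans k.state (k.tape k.pos) ∧
      k'.tape = Function.update k.tape k.pos (some s) ∧ Moves d k.pos k'.pos

/-- `C` is an accepting computation of `M` on the input `x`. -/
def IsAcceptingOn (x : List A) (C : List (Cfg Γ Q)) : Prop :=
  C.head? = some (M.init x) ∧ C.IsChain M.Step ∧ ∃ k, C.getLast? = some k ∧ k.state ∈ M.accepting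

/-- The accepted language. -/
def language : Language A := {x | ∃ C, M.IsAcceptingOn x C}

/-- The amount of the resource `r` used on the input `x` under the accept measure: the maximum of
`r C` over all accepting computations `C` on `x` (`⊤` if these values are unbounded), and `0` if
there is none. -/
noncomputable def acceptCostOn (r : List (Cfg Γ Q) → ℕ∞) (x : List A) : ℕ∞ :=
  ⨆ (C : List (Cfg Γ Q)) (_ : M.IsAcceptingOn x C), r C

/-- The amount of the resource `r` used on inputs of length `n` under the accept measure. -/
noncomputable def acceptCost (r : List (Cfg Γ Q) → ℕ∞) (n : ℕ) : ℕ∞ :=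
  ⨆ (x : List A) (_ : x.length = n), M.acceptCostOn r x

/-- Under the accept measure, `M` uses crossing sequences of length `c n`.  As `c n` is a natural
number, the supremum is a maximum. -/
def UsesCrossing (c : ℕ → ℕ) : Prop := ∀ n, M.acceptCost crossing n = (c n : ℕ∞)

/-- Under the accept measure, `M` works in time `t n`.  As `t n` is a natural number, the supremum
is a maximum. -/
def WorksInTime (t : ℕ → ℕ) : Prop := ∀ n, M.acceptCost time n = (t n : ℕ∞)

end OffLineTM

/-! The two sides of a tape boundary influence each other only through the crossing sequence there.
So accepting computations with equal crossing sequences at `b` and `b'` can be pasted together: the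
left part of one with the right part of the other (`exists_glue`). Three consequences carry the
theorem.

Gap: let `c` be unbounded and take a shortest input with a crossing sequence longer than `K`. If two
equal crossing sequences occurred within the input on the same side of the long one, the input
between them could be cut out; so each sequence occurs at most twice within the input
(`exists_crossingSeq_ne`). With `q` states there are at most `(q + 1) ^ L` sequences of length at
most `L`, so at least half of the `n` boundaries carry sequences of length at least a constant times
`log n` (`UsesCrossing.exists_logb_le`). As `K` grows, so does `n`. Hence infinitely often `c n` is
at least of order `log n`, and `t n`, which bounds the sum of all crossing sequence lengths, at
least of order `n log n`. So `c = o(log n)` and `t = o(n log n)`, in particular `t = O(n)`, each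
force `c` to be bounded.

Linear time: let `c` be bounded and `t` finite. No configuration repeats, so each stay on a square
is short, and the time is at most a constant times one plus the number of crossings. Beyond the
input the nonempty crossing sequences are distinct, since a repetition could be pumped on blank
tape; so boundedly many boundaries are crossed there (`WorksInTime.isBigO_of_bounded`).

Regularity: for bounded `c`, the set of crossing sequences possible at the end of a prefix
determines its left quotient, and there are finitely many such sets (`UsesCrossing.isRegular`). -/

namespace OffLineTM

/-! ### Cut and paste along equal crossing sequences -/

section Gluing

variable {A Γ Q : Type*} {M : OffLineTM A Γ Q}

/-- A sequence of configurations that ends in an accepting state. -/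
def IsAcceptingRun (M : OffLineTM A Γ Q) (C : List (Cfg Γ Q)) : Prop :=
  C.IsChain M.Step ∧ ∃ k, C.getLast? = some k ∧ k.state ∈ M.accepting

theorem isAcceptingRun_singleton {k : Cfg Γ Q} :
    M.IsAcceptingRun [k] ↔ k.state ∈ M.accepting := by
  simp [IsAcceptingRun]

theorem isAcceptingRun_cons_cons {k k' : Cfg Γ Q} {l : List (Cfg Γ Q)} :
    M.IsAcceptingRun (k :: k' :: l) ↔ M.Step k k' ∧ M.IsAcceptingRun (k' :: l) := by
  simp [IsAcceptingRun, and_assoc]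

theorem isAcceptingOn_iff {x : List A} {C : List (Cfg Γ Q)} :
    M.IsAcceptingOn x C ↔ ∃ l, C = M.init x :: l ∧ M.IsAcceptingRun C := by
  cases C <;> simp [IsAcceptingOn, IsAcceptingRun]

theorem crossingSeq_singleton (b : ℕ) (k : Cfg Γ Q) : crossingSeq b [k] = [] := by
  simp [crossingSeq]

theorem crossingSeq_cons_cons (b : ℕ) (k k' : Cfg Γ Q) (l : List (Cfg Γ Q)) :
    crossingSeq b (k :: k' :: l) =
      if (k.pos ≤ b ∧ b < k'.pos) ∨ (k'.pos ≤ b ∧ b < k.pos) then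
        k'.state :: crossingSeq b (k' :: l)
      else crossingSeq b (k' :: l) := by
  simp [crossingSeq]

theorem Step.pos_le {k k' : Cfg Γ Q} (h : M.Step k k') :
    k'.pos ≤ k.pos + 1 ∧ k.pos ≤ k'.pos + 1 := by
  obtain ⟨-, -, s, d, -, -, hd⟩ := h
  cases d <;> simp only [Moves] at hd <;> omega

theorem Step.tape_of_ne {k k' : Cfg Γ Q} (h : M.Step k k') {i : ℕ} (hi : i ≠ k.pos) :
    k'.tape i = k.tape i := by
  obtain ⟨-, -, s, d, -, ht, -⟩ := h
  rw [ht, Function.update_of_ne hi]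

/-- The configuration that agrees with `k` on the squares `0, …, b` and with `k'`, shifted by
`b - b'`, to the right of them. -/
def glue (b b' : ℕ) (k k' : Cfg Γ Q) : Cfg Γ Q where
  state := if k.pos ≤ b then k.state else k'.state
  pos := if k.pos ≤ b then k.pos else k'.pos - b' + b
  tape i := if i ≤ b then k.tape i else k'.tape (i - b + b')

variable {b b' : ℕ} {k k' k₁ k₁' : Cfg Γ Q}

/-- The move may stay on the left or cross the boundary. `hm` and `hs` cover both cases: after a
crossing, the glued configuration takes its state and position from `m'`. -/
theorem Step.glue_of_left {m m' : Cfg Γ Q} (h : M.Step k m) (hk : k.pos ≤ b)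
    (hm : m.pos = (glue b b' m m').pos) (hs : m.state = (glue b b' m m').state)
    (ht : ∀ i, b < i → m'.tape (i - b + b') = k'.tape (i - b + b')) :
    M.Step (glue b b' k k') (glue b b' m m') := by
  obtain ⟨h1, h2, s, d, h3, h4, h5⟩ := h
  refine ⟨by simpa [glue, hk], by simpa [glue, hk], s, d, ?_, ?_, ?_⟩
  · rw [← hs]; simpa [glue, hk] using h3
  · funext i
    by_cases hi : i ≤ b
    · simp [glue, hk, hi, h4, Function.update_apply]
    · have : i ≠ k.pos := by omega
      simp [glue, hk, hi, this, ht i (by omega)]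
  · rw [← hm]; simpa [glue, hk] using h5

theorem Step.glue_of_right {m m' : Cfg Γ Q} (h : M.Step k' m') (hk : b < k.pos) (hk' : b' < k'.pos)
    (hm : m'.pos + b = (glue b b' m m').pos + b') (hs : m'.state = (glue b b' m m').state)
    (ht : ∀ i, i ≤ b → m.tape i = k.tape i) :
    M.Step (glue b b' k k') (glue b b' m m') := by
  obtain ⟨h1, h2, s, d, h3, h4, h5⟩ := h
  have hk := hk.not_ge
  have e1 : k'.pos - b' + b' = k'.pos := by omega
  have e2 : ¬ k'.pos - b' + b ≤ b := by omega
  refine ⟨by simpa [glue, hk], by simpa [glue, hk], s, d, ?_, ?_, ?_⟩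
  · rw [← hs]; simpa [glue, hk, e1, e2] using h3
  · funext i
    by_cases hi : i ≤ b
    · have : i ≠ k'.pos - b' + b := by omega
      simp [glue, hk, hi, this, ht i hi]
    · have : i - b + b' = k'.pos ↔ i = k'.pos - b' + b := by omega
      simp [glue, hk, hi, h4, Function.update_apply, this]
  · have : (glue b b' k k').pos = k'.pos - b' + b := by simp [glue, hk]
    rw [this]
    cases d <;> simp only [Moves] at h5 ⊢ <;> omega

/-- While both heads are on the left, the second computation contributes only its tape to the right
of `b'`, which its move does not touch. -/
theorem Step.glue_eq_left (h : M.Step k' k₁') (hk : k.pos ≤ b) (hk' : k'.pos ≤ b') :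
    glue b b' k k₁' = glue b b' k k' := by
  have : ∀ i, b < i → k₁'.tape (i - b + b') = k'.tape (i - b + b') :=
    fun i hi => h.tape_of_ne (by omega)
  simp only [glue, hk, if_true, Cfg.mk.injEq, true_and]
  funext i
  split_ifs with hi
  · rfl
  · exact this i (by omega)

theorem Step.glue_eq_right (h : M.Step k k₁) (hk : b < k.pos) (hk₁ : b < k₁.pos) :
    glue b b' k₁ k' = glue b b' k k' := by
  simp only [glue, hk.not_ge, hk₁.not_ge, if_false, Cfg.mk.injEq, true_and]
  funext i
  split_ifs with hi
  · exact h.tape_of_ne (by omega)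
  · rfl

/-- A head that never crosses `b` again stays on its side. This handles the remainder of one run
after the other has accepted. -/
theorem crossingSeq_eq_nil_of_le {l : List (Cfg Γ Q)} {b i : ℕ} (h : crossingSeq b (k :: l) = [])
    (hk : k.pos ≤ b) (hi : b ≤ i) : crossingSeq i (k :: l) = [] := by
  induction l generalizing k with
  | nil => simp [crossingSeq]
  | cons m l ih =>
    rw [crossingSeq_cons_cons] at h ⊢
    split_ifs at h with hc
    rw [if_neg (by omega)]
    exact ih h (by omega)

theorem crossingSeq_eq_nil_of_ge {l : List (Cfg Γ Q)} {b i : ℕ} (h : crossingSeq b (k :: l) = [])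
    (hk : b < k.pos) (hi : i ≤ b) : crossingSeq i (k :: l) = [] := by
  induction l generalizing k with
  | nil => simp [crossingSeq]
  | cons m l ih =>
    rw [crossingSeq_cons_cons] at h ⊢
    split_ifs at h with hc
    rw [if_neg (by omega)]
    exact ih h (by omega)

/-- Both heads are kept on the same side. On the left the first run drives the glued one, on the
right the second; moves of the other run on that side are skipped. The runs cross together, in the
same state because the crossing sequences agree, and the glued run accepts when the driving run
does. -/
theorem exists_glue_run (b b' : ℕ) (k k' : Cfg Γ Q) (l l' : List (Cfg Γ Q))
    (hC : M.IsAcceptingRun (k :: l)) (hC' : M.IsAcceptingRun (k' :: l'))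
    (hpos : k.pos ≤ b ↔ k'.pos ≤ b')
    (h : crossingSeq b (k :: l) = crossingSeq b' (k' :: l')) :
    ∃ m, M.IsAcceptingRun (glue b b' k k' :: m) ∧
      (∀ i ≤ b, crossingSeq i (glue b b' k k' :: m) = crossingSeq i (k :: l)) ∧
      ∀ j, crossingSeq (b + j) (glue b b' k k' :: m) = crossingSeq (b' + j) (k' :: l') := by
  by_cases hk : k.pos ≤ b
  · have hk' := hpos.1 hk
    have gp : (glue b b' k k').pos = k.pos := by simp [glue, hk]
    match l, l' with
    | [], l' =>
      rw [crossingSeq_singleton] at h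
      refine ⟨[], ?_, fun i _ => by simp [crossingSeq], fun j => ?_⟩
      · simpa [isAcceptingRun_singleton, glue, hk] using hC
      · rw [crossingSeq_singleton, crossingSeq_eq_nil_of_le h.symm hk' (by omega)]
    | k₁ :: l, l' =>
      obtain ⟨hs, hC₁⟩ := isAcceptingRun_cons_cons.1 hC
      by_cases hk₁ : k₁.pos ≤ b
      · rw [crossingSeq_cons_cons, if_neg (by omega)] at h
        obtain ⟨m, h1, h2, h3⟩ := exists_glue_run b b' k₁ k' l l' hC₁ hC' (by omega) h
        have gp₁ : (glue b b' k₁ k').pos = k₁.pos := by simp [glue, hk₁]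
        refine ⟨glue b b' k₁ k' :: m, isAcceptingRun_cons_cons.2 ⟨?_, h1⟩, fun i hi => ?_,
          fun j => ?_⟩
        · exact hs.glue_of_left hk gp₁.symm (by simp [glue, hk₁]) fun _ _ => rfl
        · rw [crossingSeq_cons_cons, crossingSeq_cons_cons, h2 i hi, gp, gp₁]
          simp [glue, hk₁]
        · rw [crossingSeq_cons_cons, if_neg (by omega), h3]
      · match l' with
        | [] =>
          rw [crossingSeq_cons_cons, if_pos (by omega), crossingSeq_singleton] at h
          simp at h
        | k₁' :: l' =>
          obtain ⟨hs', hC₁'⟩ := isAcceptingRun_cons_cons.1 hC'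
          -- The first run is about to cross. The second is advanced, without effect on the glued
          -- configuration, until it is about to cross as well.
          by_cases hk₁' : k₁'.pos ≤ b'
          · rw [crossingSeq_cons_cons b' k', if_neg (by omega)] at h
            obtain ⟨m, h1, h2, h3⟩ := exists_glue_run b b' k k₁' (k₁ :: l) l' hC hC₁' (by omega) h
            rw [hs'.glue_eq_left hk hk'] at h1 h2 h3
            refine ⟨m, h1, h2, fun j => ?_⟩
            rw [crossingSeq_cons_cons _ k', if_neg (by omega), h3]
          · rw [crossingSeq_cons_cons, if_pos (by omega), crossingSeq_cons_cons, if_pos (by omega),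
              List.cons.injEq] at h
            obtain ⟨m, h1, h2, h3⟩ := exists_glue_run b b' k₁ k₁' l l' hC₁ hC₁' (by omega) h.2
            -- Heads move by one square, so the crossings lead exactly to `b + 1` and `b' + 1`,
            -- which the shift identifies.
            have p1 := hs.pos_le
            have p2 := hs'.pos_le
            have gp₁ : (glue b b' k₁ k₁').pos = k₁.pos := by simp [glue, hk₁]; omega
            have gs₁ : (glue b b' k₁ k₁').state = k₁.state := by simp [glue, hk₁, h.1]
            refine ⟨glue b b' k₁ k₁' :: m, isAcceptingRun_cons_cons.2 ⟨?_, h1⟩, fun i hi => ?_,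
              fun j => ?_⟩
            · exact hs.glue_of_left hk gp₁.symm gs₁.symm fun _ _ => hs'.tape_of_ne (by omega)
            · rw [crossingSeq_cons_cons, crossingSeq_cons_cons, h2 i hi, gp, gp₁, gs₁]
            · rw [crossingSeq_cons_cons, crossingSeq_cons_cons, h3 j, gp, gp₁, gs₁, h.1]
              congr 1
              simp only [eq_iff_iff]
              omega
  · have hk' := mt hpos.2 hk
    have gp : (glue b b' k k').pos + b' = k'.pos + b := by simp [glue, hk]; omega
    match l', l with
    | [], l =>
      rw [crossingSeq_singleton] at h
      refine ⟨[], ?_, fun i hi => ?_, fun j => by simp [crossingSeq]⟩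
      · simpa [isAcceptingRun_singleton, glue, hk] using hC'
      · rw [crossingSeq_singleton, crossingSeq_eq_nil_of_ge h (by omega) hi]
    | k₁' :: l', l =>
      obtain ⟨hs', hC₁'⟩ := isAcceptingRun_cons_cons.1 hC'
      by_cases hk₁' : k₁'.pos ≤ b'
      · match l with
        | [] =>
          rw [crossingSeq_cons_cons, if_pos (by omega), crossingSeq_singleton] at h
          simp at h
        | k₁ :: l =>
          obtain ⟨hs, hC₁⟩ := isAcceptingRun_cons_cons.1 hC
          by_cases hk₁ : k₁.pos ≤ b
          · rw [crossingSeq_cons_cons, if_pos (by omega), crossingSeq_cons_cons, if_pos (by omega),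
              List.cons.injEq] at h
            obtain ⟨m, h1, h2, h3⟩ := exists_glue_run b b' k₁ k₁' l l' hC₁ hC₁' (by omega) h.2
            have p1 := hs.pos_le
            have p2 := hs'.pos_le
            have gp₁ : (glue b b' k₁ k₁').pos = k₁.pos := by simp [glue, hk₁]
            have gs₁ : (glue b b' k₁ k₁').state = k₁.state := by simp [glue, hk₁]
            refine ⟨glue b b' k₁ k₁' :: m, isAcceptingRun_cons_cons.2 ⟨?_, h1⟩, fun i hi => ?_,
              fun j => ?_⟩
            · exact hs'.glue_of_right (by omega) (by omega) (by omega) (by rw [gs₁, h.1])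
                fun _ _ => hs.tape_of_ne (by omega)
            · rw [crossingSeq_cons_cons, crossingSeq_cons_cons, h2 i hi, gp₁, gs₁]
              congr 1
              simp only [eq_iff_iff]
              omega
            · rw [crossingSeq_cons_cons, crossingSeq_cons_cons, h3 j, gp₁, gs₁, h.1]
              congr 1
              simp only [eq_iff_iff]
              omega
          · rw [crossingSeq_cons_cons b k, if_neg (by omega)] at h
            obtain ⟨m, h1, h2, h3⟩ := exists_glue_run b b' k₁ k' l (k₁' :: l') hC₁ hC' (by omega) h
            rw [hs.glue_eq_right (by omega) (by omega)] at h1 h2 h3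
            refine ⟨m, h1, fun i hi => ?_, h3⟩
            rw [crossingSeq_cons_cons _ k, if_neg (by omega), h2 i hi]
      · rw [crossingSeq_cons_cons b', if_neg (by omega)] at h
        obtain ⟨m, h1, h2, h3⟩ := exists_glue_run b b' k k₁' l l' hC hC₁' (by omega) h
        have gp₁ : (glue b b' k k₁').pos + b' = k₁'.pos + b := by simp [glue, hk]; omega
        have gs₁ : (glue b b' k k₁').state = k₁'.state := by simp [glue, hk]
        refine ⟨glue b b' k k₁' :: m, isAcceptingRun_cons_cons.2 ⟨?_, h1⟩, fun i hi => ?_,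
          fun j => ?_⟩
        · exact hs'.glue_of_right (by omega) (by omega) gp₁.symm gs₁.symm fun _ _ => rfl
        · rw [crossingSeq_cons_cons, if_neg (by omega), h2 i hi]
        · rw [crossingSeq_cons_cons, crossingSeq_cons_cons, h3 j, gs₁]
          congr 1
          simp only [eq_iff_iff]
          omega
  termination_by l.length + l'.length

/-- Two accepting computations with equal crossing sequences at the boundaries `b` and `b'` can be
combined to one that behaves like the first to the left of the boundary and like the second to the
right of it. -/
theorem exists_glue {x x' y : List A} {C C' : List (Cfg Γ Q)} (hC : M.IsAcceptingOn x C)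
    (hC' : M.IsAcceptingOn x' C') (h : crossingSeq b C = crossingSeq b' C')
    (hl : ∀ i ≤ b, y[i]? = x[i]?) (hr : ∀ j, y[b + 1 + j]? = x'[b' + 1 + j]?) :
    ∃ D, M.IsAcceptingOn y D ∧ (∀ i ≤ b, crossingSeq i D = crossingSeq i C) ∧
      ∀ j, crossingSeq (b + j) D = crossingSeq (b' + j) C' := by
  obtain ⟨l, rfl, hl1⟩ := isAcceptingOn_iff.1 hC
  obtain ⟨l', rfl, hl'1⟩ := isAcceptingOn_iff.1 hC'
  obtain ⟨m, h1, h2, h3⟩ := exists_glue_run b b' _ _ l l' hl1 hl'1 (by simp [init]) h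
  have e : glue b b' (M.init x) (M.init x') = M.init y := by
    simp only [glue, init, zero_le, if_true, Cfg.mk.injEq, true_and]
    funext i
    split_ifs with hi
    · rw [hl i hi]
    · have := hr (i - (b + 1))
      rw [show b + 1 + (i - (b + 1)) = i by omega,
        show b' + 1 + (i - (b + 1)) = i - b + b' by omega] at this
      rw [this]
  rw [e] at h1 h2 h3
  exact ⟨_, isAcceptingOn_iff.2 ⟨m, rfl, h1⟩, h2, h3⟩

end Gluing

end OffLineTM
namespace OffLineTM

/-! ### Time against crossings, pumping on blank tape, and pigeonhole counts -/

section Counting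

variable {A Γ Q : Type*} {M : OffLineTM A Γ Q}

/-- A move crosses at most one boundary, namely the one numbered by the smaller of the two
positions. -/
theorem sum_length_crossingSeq_le {C : List (Cfg Γ Q)} (hC : C.IsChain M.Step) (S : Finset ℕ) :
    ∑ b ∈ S, (crossingSeq b C).length ≤ C.tail.length := by
  induction C with
  | nil => simp [crossingSeq]
  | cons k l ih =>
    cases l with
    | nil => simp [crossingSeq]
    | cons k' l =>
      obtain ⟨hs, hC'⟩ := List.isChain_cons_cons.1 hC
      have hp := hs.pos_le
      have key : ∀ b ∈ S, (crossingSeq b (k :: k' :: l)).length ≤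
          (if b = min k.pos k'.pos then 1 else 0) + (crossingSeq b (k' :: l)).length := by
        intro b _
        rw [crossingSeq_cons_cons]
        split_ifs with h1 h2 h2
        · simp [add_comm]
        · omega
        · omega
        · omega
      refine (Finset.sum_le_sum key).trans ?_
      rw [Finset.sum_add_distrib, Finset.sum_ite_eq']
      have := ih hC'
      simp only [List.tail_cons, List.length_cons] at this ⊢
      split_ifs <;> omega

theorem IsAcceptingOn.isChain {x : List A} {C : List (Cfg Γ Q)} (hC : M.IsAcceptingOn x C) :
    C.IsChain M.Step := hC.2.1

theorem exists_pos_lt {C : List (Cfg Γ Q)} : ∃ B, ∀ k ∈ C, k.pos < B := by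
  induction C with
  | nil => simp
  | cons k l ih =>
    obtain ⟨B, hB⟩ := ih
    refine ⟨max B (k.pos + 1), ?_⟩
    simp only [List.mem_cons, forall_eq_or_imp]
    exact ⟨by omega, fun m hm => lt_of_lt_of_le (hB m hm) (le_max_left _ _)⟩

theorem tape_eq_of_mem_takeWhile {k : Cfg Γ Q} {l : List (Cfg Γ Q)}
    (hC : (k :: l).IsChain M.Step) :
    ∀ m ∈ (k :: l).takeWhile (fun m => decide (m.pos = k.pos)),
      m.pos = k.pos ∧ ∀ i ≠ k.pos, m.tape i = k.tape i := by
  induction l generalizing k with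
  | nil => simp
  | cons k' l ih =>
    obtain ⟨hs, hC'⟩ := List.isChain_cons_cons.1 hC
    intro m hm
    rw [List.takeWhile_cons_of_pos (by simp), List.mem_cons] at hm
    rcases hm with rfl | hm
    · simp
    · by_cases hp : k'.pos = k.pos
      · rw [← hp] at hm
        obtain ⟨h1, h2⟩ := ih hC' m hm
        refine ⟨h1.trans hp, fun i hi => ?_⟩
        rw [h2 i (hp ▸ hi), hs.tape_of_ne hi]
      · simp [hp] at hm

/-- During a stay on one square only the state and the scanned symbol vary, so without repeated
configurations there are at most as many configurations as such pairs. -/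
theorem length_takeWhile_le [Finite Γ] [Finite Q] {k : Cfg Γ Q} {l : List (Cfg Γ Q)}
    (hC : (k :: l).IsChain M.Step) (hn : (k :: l).Nodup) :
    ((k :: l).takeWhile (fun m => decide (m.pos = k.pos))).length ≤ Nat.card (Q × Option Γ) := by
  classical
  set W := (k :: l).takeWhile (fun m => decide (m.pos = k.pos)) with hW
  have hWn : W.Nodup := hn.sublist (List.takeWhile_sublist _)
  have hmem := tape_eq_of_mem_takeWhile hC
  have hmap : (W.map fun m => (m.state, m.tape k.pos)).Nodup := by
    refine hWn.map_on ?_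
    rintro ⟨s, p, t⟩ h1 ⟨s', p', t'⟩ h2 h
    obtain ⟨e1, e2⟩ := hmem _ h1
    obtain ⟨e1', e2'⟩ := hmem _ h2
    simp only [Prod.mk.injEq, Cfg.mk.injEq] at *
    refine ⟨h.1, e1.trans e1'.symm, ?_⟩
    funext i
    by_cases hi : i = k.pos
    · rw [hi, h.2]
    · rw [e2 i hi, e2' i hi]
  have := Fintype.ofFinite (Q × Option Γ)
  rw [Nat.card_eq_fintype_card]
  simpa using hmap.length_le_card

/-- The computation splits into stays on single squares. Every stay but the first begins with a
crossing. -/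
theorem length_le_of_nodup [Finite Γ] [Finite Q] {C : List (Cfg Γ Q)} (hC : C.IsChain M.Step)
    (hn : C.Nodup) {B : ℕ} (hB : ∀ k ∈ C, k.pos < B) :
    C.length ≤ Nat.card (Q × Option Γ) * (∑ b ∈ Finset.range B, (crossingSeq b C).length + 1) := by
  cases C with
  | nil => simp
  | cons k l =>
    -- The first stay enters with its actual length, which grows by one when a configuration on the
    -- same square is prepended. It is replaced by its uniform bound only when a crossing precedes
    -- it.
    suffices h : (k :: l).length ≤
        Nat.card (Q × Option Γ) * (∑ b ∈ Finset.range B, (crossingSeq b (k :: l)).length) +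
          ((k :: l).takeWhile (fun m => decide (m.pos = k.pos))).length by
      have := length_takeWhile_le hC hn
      rw [mul_add, mul_one]
      omega
    induction l generalizing k with
    | nil => simp
    | cons k' l ih =>
      obtain ⟨hs, hC'⟩ := List.isChain_cons_cons.1 hC
      have hn' := (List.nodup_cons.1 hn).2
      have hB' := fun m hm => hB m (List.mem_cons_of_mem _ hm)
      have IH := ih k' hC' hn' hB'
      have hT := length_takeWhile_le hC' hn'
      have hp := hs.pos_le
      rw [List.takeWhile_cons_of_pos (by simp)]
      by_cases he : k'.pos = k.pos
      · have : ∀ b, crossingSeq b (k :: k' :: l) = crossingSeq b (k' :: l) := fun b => by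
          rw [crossingSeq_cons_cons, if_neg (by omega)]
        simp only [this]
        rw [he] at IH
        simp only [List.length_cons] at IH ⊢
        omega
      · have key : ∀ b, (crossingSeq b (k :: k' :: l)).length =
            (if b = min k.pos k'.pos then 1 else 0) + (crossingSeq b (k' :: l)).length := by
          intro b
          rw [crossingSeq_cons_cons]
          split_ifs with h1 h2 h2
          · simp [add_comm]
          · omega
          · omega
          · omega
        have hm : min k.pos k'.pos ∈ Finset.range B := by
          have := hB k (by simp)
          simp only [Finset.mem_range]
          omega
        simp only [key]
        rw [Finset.sum_add_distrib, Finset.sum_ite_eq', if_pos hm, mul_add, mul_one]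
        simp only [List.length_cons] at IH ⊢
        omega

theorem exists_eq_append_of_not_nodup {α : Type*} {l : List α} (h : ¬ l.Nodup) :
    ∃ a u v w, l = u ++ a :: (v ++ a :: w) := by
  induction l with
  | nil => simp at h
  | cons b l ih =>
    by_cases hb : b ∈ l
    · obtain ⟨v, w, rfl⟩ := List.append_of_mem hb
      exact ⟨b, [], v, w, rfl⟩
    · obtain ⟨a, u, v, w, rfl⟩ := ih fun hn => h (List.nodup_cons.2 ⟨hb, hn⟩)
      exact ⟨a, b :: u, v, w, rfl⟩

/-- A computation that repeats a configuration can be made arbitrarily long. -/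
theorem exists_longer_of_not_nodup {x : List A} {C : List (Cfg Γ Q)} (hC : M.IsAcceptingOn x C)
    (hn : ¬ C.Nodup) :
    ∃ D, M.IsAcceptingOn x D ∧ ¬ D.Nodup ∧ C.length < D.length := by
  obtain ⟨a, u, v, w, rfl⟩ := exists_eq_append_of_not_nodup hn
  obtain ⟨h1, h2, h3⟩ := hC
  refine ⟨u ++ a :: (v ++ a :: (v ++ a :: w)), ⟨?_, ?_, ?_⟩, ?_, ?_⟩
  · cases u <;> simpa using h1
  · have s1 := List.isChain_split.1 h2
    rw [← List.cons_append] at s1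
    have s2 := List.isChain_split.1 s1.2
    exact List.isChain_split.2 ⟨s1.1, (List.isChain_split (l₁ := a :: v)).2 ⟨s2.1,
      (List.isChain_split (l₁ := a :: v)).2 s2⟩⟩
  · rw [List.getLast?_append_cons, ← List.cons_append, List.getLast?_append_cons] at h3 ⊢
    rwa [← List.cons_append, List.getLast?_append_cons]
  · simp [List.nodup_append]
  · simp only [List.length_append, List.length_cons]
    omega

theorem nodup_of_length_le {x : List A} {T : ℕ} (hT : ∀ C, M.IsAcceptingOn x C → C.length ≤ T)
    {C : List (Cfg Γ Q)} (hC : M.IsAcceptingOn x C) : C.Nodup := by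
  by_contra hn
  have : ∀ m, ∃ D, M.IsAcceptingOn x D ∧ ¬ D.Nodup ∧ m ≤ D.length := by
    intro m
    induction m with
    | zero => exact ⟨C, hC, hn, by omega⟩
    | succ m ih =>
      obtain ⟨D, h1, h2, h3⟩ := ih
      obtain ⟨E, h4, h5, h6⟩ := exists_longer_of_not_nodup h1 h2
      exact ⟨E, h4, h5, by omega⟩
  obtain ⟨D, h1, -, h3⟩ := this (T + 1)
  have := hT D h1
  omega

/-- On the blank part of the tape, a repeated nonempty crossing sequence can be pumped. -/
theorem crossingSeq_ne_of_length_le {x : List A} {T : ℕ}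
    (hT : ∀ C, M.IsAcceptingOn x C → C.length ≤ T) {C : List (Cfg Γ Q)}
    (hC : M.IsAcceptingOn x C) {b b' : ℕ} (hb : x.length ≤ b) (hbb : b < b')
    (hne : crossingSeq b C ≠ []) : crossingSeq b C ≠ crossingSeq b' C := by
  intro he
  -- Pasting the part of `C` to the right of `b` at the boundary `d` of `D` repeats the segment from
  -- `b` to `b'`. The input stays `x`, since only blank squares are shifted, and `S` collects the
  -- successive values of `d`, all of them crossed. More than `T` crossed boundaries contradict the
  -- time bound.
  have key : ∀ m, ∃ D S, M.IsAcceptingOn x D ∧ (∃ d, b ≤ d ∧ crossingSeq d D = crossingSeq b C ∧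
      S ⊆ Finset.range d) ∧ S.card = m ∧ ∀ i ∈ S, crossingSeq i D ≠ [] := by
    intro m
    induction m with
    | zero => exact ⟨C, ∅, hC, ⟨b, le_rfl, rfl, by simp⟩, by simp, by simp⟩
    | succ m ih =>
      obtain ⟨D, S, h1, ⟨d, h2, h3, h4⟩, h5, h6⟩ := ih
      have h4' : ∀ i ∈ S, i < d := fun i hi => Finset.mem_range.1 (h4 hi)
      obtain ⟨E, h7, h8, h9⟩ := exists_glue (y := x) h1 hC h3 (fun _ _ => rfl) fun j => by
        rw [List.getElem?_eq_none (by omega), List.getElem?_eq_none (by omega)]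
      refine ⟨E, insert d S, h7, ⟨d + (b' - b), by omega, ?_, ?_⟩, ?_, ?_⟩
      · rw [h9, show b + (b' - b) = b' by omega, he]
      · intro i hi
        rcases Finset.mem_insert.1 hi with rfl | hi
        · simp only [Finset.mem_range]; omega
        · have := h4' i hi
          simp only [Finset.mem_range]; omega
      · rw [Finset.card_insert_of_notMem fun hd => (h4' d hd).ne rfl, h5]
      · intro i hi
        rcases Finset.mem_insert.1 hi with rfl | hi
        · rw [h8 _ le_rfl, h3]; exact hne
        · rw [h8 _ (h4' i hi).le]; exact h6 i hi
  obtain ⟨D, S, h1, -, h5, h6⟩ := key (T + 1)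
  have h7 := sum_length_crossingSeq_le h1.isChain S
  have h8 : S.card • 1 ≤ ∑ i ∈ S, (crossingSeq i D).length :=
    Finset.card_nsmul_le_sum _ _ _ fun i hi => List.length_pos_iff.2 (h6 i hi)
  have := hT D h1
  simp only [List.length_tail, smul_eq_mul, mul_one] at h7 h8
  omega

/-- There are at most `(q + 1) ^ L` lists of length at most `L` over an alphabet of size `q`. -/
theorem card_le_pow_of_injOn {α ι : Type*} [Finite α] {S : Finset ι} {f : ι → List α} {L : ℕ}
    (hf : Set.InjOn f S) (hL : ∀ i ∈ S, (f i).length ≤ L) :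
    S.card ≤ (Nat.card α + 1) ^ L := by
  have := Fintype.ofFinite α
  have h : S.card ≤ (Finset.univ : Finset (Fin L → Option α)).card := by
    refine Finset.card_le_card_of_injOn (fun i j => (f i)[(j : ℕ)]?) (by simp) ?_
    intro i hi i' hi' h
    refine hf hi hi' (List.ext_getElem? fun j => ?_)
    by_cases hj : j < L
    · exact congrFun h ⟨j, hj⟩
    · rw [List.getElem?_eq_none (by have := hL i hi; omega),
        List.getElem?_eq_none (by have := hL i' hi'; omega)]
  simpa using h

/-- As no value occurs three times, `f` is injective on the indices whose value recurs later, and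
also on those whose value does not. -/
theorem card_le_two_mul_pow {α : Type*} [Finite α] {S : Finset ℕ} {f : ℕ → List α} {L : ℕ}
    (hf : ∀ i ∈ S, ∀ j ∈ S, ∀ k ∈ S, i < j → j < k → f i = f j → f j ≠ f k)
    (hL : ∀ i ∈ S, (f i).length ≤ L) :
    S.card ≤ 2 * (Nat.card α + 1) ^ L := by
  classical
  let S₁ := S.filter fun i => ∃ j ∈ S, i < j ∧ f i = f j
  let S₂ := S.filter fun i => ¬ ∃ j ∈ S, i < j ∧ f i = f j
  have hS : S₁.card + S₂.card = S.card := Finset.card_filter_add_card_filter_not _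
  have h₁ : S₁.card ≤ (Nat.card α + 1) ^ L := by
    refine card_le_pow_of_injOn (f := f) ?_ fun i hi => hL i (Finset.filter_subset _ _ hi)
    intro i hi i' hi' h
    simp only [S₁, Finset.coe_filter, Set.mem_ofPred_eq] at hi hi'
    obtain ⟨hi, j, hj, hij, e⟩ := hi
    obtain ⟨hi', j', hj', hij', e'⟩ := hi'
    rcases lt_trichotomy i i' with hlt | rfl | hlt
    · exact absurd e' (hf i hi i' hi' j' hj' hlt hij' h)
    · rfl
    · exact absurd e (hf i' hi' i hi j hj hlt hij h.symm)
  have h₂ : S₂.card ≤ (Nat.card α + 1) ^ L := by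
    refine card_le_pow_of_injOn (f := f) ?_ fun i hi => hL i (Finset.filter_subset _ _ hi)
    intro i hi i' hi' h
    simp only [S₂, Finset.coe_filter, Set.mem_ofPred_eq] at hi hi'
    rcases lt_trichotomy i i' with hlt | rfl | hlt
    · exact absurd ⟨i', hi'.1, hlt, h⟩ hi.2
    · rfl
    · exact absurd ⟨i, hi.1, hlt, h.symm⟩ hi'.2
  omega

end Counting

end OffLineTM
namespace OffLineTM

/-! ### Gap theorems, linear time and regularity -/

section Resources

variable {A Γ Q : Type*} {M : OffLineTM A Γ Q}

theorem le_acceptCost (r : List (Cfg Γ Q) → ℕ∞) {x : List A} {C : List (Cfg Γ Q)}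
    (hC : M.IsAcceptingOn x C) : r C ≤ M.acceptCost r x.length :=
  (le_iSup₂ (f := fun C (_ : M.IsAcceptingOn x C) => r C) C hC).trans
    (le_iSup₂ (f := fun x' (_ : x'.length = x.length) => M.acceptCostOn r x') x rfl)

theorem acceptCost_le {r : List (Cfg Γ Q) → ℕ∞} {n : ℕ} {a : ℕ∞}
    (h : ∀ x C, x.length = n → M.IsAcceptingOn x C → r C ≤ a) : M.acceptCost r n ≤ a :=
  iSup₂_le fun x hx => iSup₂_le fun C hC => h x C hx hC

theorem UsesCrossing.length_le {c : ℕ → ℕ} (hc : M.UsesCrossing c) {x : List A}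
    {C : List (Cfg Γ Q)} (hC : M.IsAcceptingOn x C) (b : ℕ) :
    (crossingSeq b C).length ≤ c x.length := by
  have h := le_acceptCost crossing hC
  rw [hc] at h
  exact_mod_cast (le_iSup (fun b => ((crossingSeq b C).length : ℕ∞)) b).trans h

theorem UsesCrossing.exists_lt {c : ℕ → ℕ} (hc : M.UsesCrossing c) {K n : ℕ} (h : K < c n) :
    ∃ x C b, M.IsAcceptingOn x C ∧ K < (crossingSeq b C).length := by
  by_contra! hcon
  have h1 : M.acceptCost crossing n ≤ (K : ℕ∞) :=
    acceptCost_le fun x C _ hC => iSup_le fun b => by exact_mod_cast hcon x C b hC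
  rw [hc] at h1
  have : c n ≤ K := by exact_mod_cast h1
  omega

theorem WorksInTime.tail_length_le {t : ℕ → ℕ} (ht : M.WorksInTime t) {x : List A}
    {C : List (Cfg Γ Q)} (hC : M.IsAcceptingOn x C) : C.tail.length ≤ t x.length := by
  have h := le_acceptCost time hC
  rw [ht, time] at h
  exact_mod_cast h

theorem WorksInTime.exists_usesCrossing {t : ℕ → ℕ} (ht : M.WorksInTime t) :
    ∃ c, M.UsesCrossing c := by
  have h : ∀ n, ∃ m : ℕ, M.acceptCost crossing n = m := by
    intro n
    have h1 : M.acceptCost crossing n ≤ (t n : ℕ∞) := by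
      refine acceptCost_le fun x C hx hC => iSup_le fun b => ?_
      have h2 := sum_length_crossingSeq_le hC.isChain {b}
      rw [Finset.sum_singleton] at h2
      exact_mod_cast hx ▸ h2.trans (ht.tail_length_le hC)
    exact ⟨_, (ENat.natCast_toNat (ne_top_of_le_ne_top (ENat.natCast_ne_top _) h1)).symm⟩
  choose c hc using h
  exact ⟨c, hc⟩

/-- In an accepting computation on a shortest input that leads to a crossing sequence of at least a
given length, no crossing sequence occurs three times within the input. -/
theorem exists_crossingSeq_ne {K : ℕ}
    (h : ∃ x C b, M.IsAcceptingOn x C ∧ K < (crossingSeq b C).length) :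
    ∃ x C b, M.IsAcceptingOn x C ∧ K < (crossingSeq b C).length ∧
      ∀ i j k, i < j → j < k → k < x.length → crossingSeq i C = crossingSeq j C →
        crossingSeq j C ≠ crossingSeq k C := by
  classical
  have hex : ∃ n, ∃ x C b, x.length = n ∧ M.IsAcceptingOn x C ∧ K < (crossingSeq b C).length := by
    obtain ⟨x, C, b, h⟩ := h
    exact ⟨_, x, C, b, rfl, h⟩
  obtain ⟨x, C, b, hx, hC, hK⟩ := Nat.find_spec hex
  refine ⟨x, C, b, hC, hK, ?_⟩
  -- Deleting the squares `i + 1, …, j` shortens the input but keeps the long crossing sequence, at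
  -- `b` or shifted to `i + (b - j)`, contrary to minimality. Of three equal crossing sequences, two
  -- adjacent ones lie on the same side of `b`.
  have cut : ∀ i j, i < j → j < x.length → (b ≤ i ∨ j ≤ b) →
      crossingSeq i C ≠ crossingSeq j C := by
    intro i j hij hj hb he
    obtain ⟨D, h1, h2, h3⟩ := exists_glue (y := x.take (i + 1) ++ x.drop (j + 1)) hC hC he
      (fun m hm => by
        rw [List.getElem?_append_left (by rw [List.length_take]; omega),
          List.getElem?_take_of_lt (by omega)])
      (fun m => by
        have hl : (x.take (i + 1)).length = i + 1 := by rw [List.length_take]; omega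
        rw [List.getElem?_append_right (by omega), hl, List.getElem?_drop]
        congr 1
        omega)
    have hy : (x.take (i + 1) ++ x.drop (j + 1)).length < Nat.find hex := by
      rw [List.length_append, List.length_take, List.length_drop]
      omega
    refine Nat.find_min hex hy ?_
    rcases hb with hb | hb
    · exact ⟨_, D, b, rfl, h1, by rwa [h2 b hb]⟩
    · refine ⟨_, D, i + (b - j), rfl, h1, ?_⟩
      rwa [h3, show j + (b - j) = b by omega]
  intro i j k hij hjk hk hij'
  by_cases hb : b ≤ j
  · exact cut j k hjk hk (.inl hb)
  · exact absurd hij' (cut i j hij (by omega) (.inr (by omega)))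

theorem UsesCrossing.exists_many_long [Finite Q] {c : ℕ → ℕ} (hc : M.UsesCrossing c)
    (hunb : ∀ K, ∃ n, K < c n) (N : ℕ) :
    ∃ x C, M.IsAcceptingOn x C ∧ N ≤ x.length ∧
      ∀ L, 4 * (Nat.card Q + 1) ^ L ≤ x.length → ∃ S : Finset ℕ, x.length ≤ 2 * S.card ∧
        ∀ b ∈ S, L + 1 ≤ (crossingSeq b C).length := by
  -- The sum dominates `c i` for every `i < N`, so a longer crossing sequence needs an input of
  -- length at least `N`.
  obtain ⟨n, hn⟩ := hunb (∑ i ∈ Finset.range N, c i)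
  obtain ⟨x, C, b, hC, hK, hne⟩ := exists_crossingSeq_ne (hc.exists_lt hn)
  refine ⟨x, C, hC, ?_, fun L hL => ?_⟩
  · by_contra! hlt
    have h1 := hc.length_le hC b
    have h2 := Finset.single_le_sum (f := c) (fun _ _ => Nat.zero_le _)
      (Finset.mem_range.2 hlt)
    omega
  · let S := (Finset.range x.length).filter fun i => L + 1 ≤ (crossingSeq i C).length
    let S' := (Finset.range x.length).filter fun i => ¬ L + 1 ≤ (crossingSeq i C).length
    have hS : S.card + S'.card = x.length :=
      (Finset.card_filter_add_card_filter_not _).trans (Finset.card_range _)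
    have hS' : S'.card ≤ 2 * (Nat.card Q + 1) ^ L := by
      refine card_le_two_mul_pow (f := fun i => crossingSeq i C) ?_ ?_
      · intro i _ j _ k hk hij hjk
        exact hne i j k hij hjk (Finset.mem_range.1 (Finset.filter_subset _ _ hk))
      · intro i hi
        have := (Finset.mem_filter.1 hi).2
        omega
    exact ⟨S, by omega, fun b hb => (Finset.mem_filter.1 hb).2⟩

/-- The common source of both gaps: one boundary of `S` bounds `c` from below, and summing over all
of `S` bounds `t`. -/
theorem UsesCrossing.exists_logb_le [Finite Q] {c : ℕ → ℕ} (hc : M.UsesCrossing c)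
    (hunb : ∀ K, ∃ n, K < c n) :
    ∃ D : ℝ, 0 ≤ D ∧ ∀ N, ∃ x C, M.IsAcceptingOn x C ∧ N ≤ x.length ∧ ∃ (L : ℕ) (S : Finset ℕ),
      Real.logb 2 x.length ≤ D * (L + 1 : ℕ) ∧ x.length ≤ 2 * S.card ∧
        ∀ b ∈ S, L + 1 ≤ (crossingSeq b C).length := by
  have hQ : 0 < Nat.card Q := Nat.card_pos_iff.2 ⟨⟨M.start⟩, ‹_›⟩
  have h1 : (1 : ℝ) ≤ (4 * (Nat.card Q + 1) : ℕ) := by exact_mod_cast (by omega)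
  refine ⟨Real.logb 2 (4 * (Nat.card Q + 1) : ℕ), Real.logb_nonneg one_lt_two h1, fun N => ?_⟩
  obtain ⟨x, C, hC, hN, h⟩ := hc.exists_many_long hunb (max N 4)
  have h4 : 4 ≤ x.length := (le_max_right _ _).trans hN
  -- The largest `L` for which short crossing sequences fill at most half of the boundaries. The
  -- bound `4 ≤ x.length` keeps the argument of the logarithm nonzero.
  set L := Nat.log (Nat.card Q + 1) (x.length / 4) with hL
  have hlow : (Nat.card Q + 1) ^ L ≤ x.length / 4 := Nat.pow_log_le_self _ (by omega)
  have hupp : x.length / 4 < (Nat.card Q + 1) ^ (L + 1) :=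
    Nat.lt_pow_succ_log_self (by omega) _
  obtain ⟨S, hS, hS'⟩ := h L (by omega)
  refine ⟨x, C, hC, (le_max_left _ _).trans hN, L, S, ?_, hS, hS'⟩
  have h5 : x.length ≤ (4 * (Nat.card Q + 1)) ^ (L + 1) := by
    have h6 : 4 ≤ 4 ^ (L + 1) := Nat.le_self_pow (by omega) 4
    rw [mul_pow]
    calc x.length ≤ 4 * (Nat.card Q + 1) ^ (L + 1) := by omega
      _ ≤ _ := Nat.mul_le_mul_right _ h6
  have h7 : Real.logb 2 x.length ≤ Real.logb 2 (((4 * (Nat.card Q + 1)) ^ (L + 1) : ℕ) : ℝ) :=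
    Real.logb_le_logb_of_le one_lt_two (by exact_mod_cast (by omega)) (by exact_mod_cast h5)
  rwa [Nat.cast_pow, Real.logb_pow, mul_comm] at h7

theorem not_isLittleO_of_frequently_le {f g : ℕ → ℝ} {D : ℝ} (hD : 0 ≤ D)
    (h : ∀ N, ∃ n, N ≤ n ∧ 0 < g n ∧ g n ≤ D * f n) : ¬ f =o[atTop] g := by
  intro hfg
  -- With this constant, `(D + 1) * |f n| ≤ g n ≤ D * |f n|`, which is impossible since `g n > 0`
  -- forces `|f n| > 0`.
  have hε : 0 < 1 / (D + 1) := by positivity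
  obtain ⟨N, hN⟩ := eventually_atTop.1 (hfg.def hε)
  obtain ⟨n, hn, hg, hle⟩ := h N
  have h1 := hN n hn
  rw [Real.norm_eq_abs, Real.norm_eq_abs, abs_of_pos hg, one_div, ← div_eq_inv_mul,
    le_div_iff₀ (by positivity)] at h1
  have h2 := le_abs_self (f n)
  have h3 := mul_le_mul_of_nonneg_left h2 hD
  have h4 : 0 < |f n| := by
    rcases (abs_nonneg (f n)).lt_or_eq with h | h
    · exact h
    · rw [← h, mul_zero] at h3; linarith
  nlinarith

theorem UsesCrossing.bounded_of_isLittleO [Finite Q] {c : ℕ → ℕ} (hc : M.UsesCrossing c)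
    (h : (fun n : ℕ => (c n : ℝ)) =o[atTop] (fun n : ℕ => Real.logb 2 (n : ℝ))) :
    ∃ K, ∀ n, c n ≤ K := by
  by_contra! hunb
  obtain ⟨D, hD, hx⟩ := hc.exists_logb_le hunb
  refine not_isLittleO_of_frequently_le hD (fun N => ?_) h
  obtain ⟨x, C, hC, hN, L, S, h1, h2, h3⟩ := hx (max N 2)
  have hx2 : 2 ≤ x.length := (le_max_right _ _).trans hN
  refine ⟨x.length, (le_max_left _ _).trans hN,
    Real.logb_pos one_lt_two (by exact_mod_cast hx2), h1.trans ?_⟩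
  obtain ⟨b, hb⟩ : S.Nonempty := Finset.card_pos.1 (by omega)
  have := (h3 b hb).trans (hc.length_le hC b)
  gcongr

theorem UsesCrossing.bounded_of_worksInTime [Finite Q] {c t : ℕ → ℕ} (hc : M.UsesCrossing c)
    (ht : M.WorksInTime t)
    (h : (fun n : ℕ => (t n : ℝ)) =o[atTop] (fun n : ℕ => (n : ℝ) * Real.logb 2 (n : ℝ))) :
    ∃ K, ∀ n, c n ≤ K := by
  by_contra! hunb
  obtain ⟨D, hD, hx⟩ := hc.exists_logb_le hunb
  refine not_isLittleO_of_frequently_le (D := D * 2) (by positivity) (fun N => ?_) h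
  obtain ⟨x, C, hC, hN, L, S, h1, h2, h3⟩ := hx (max N 2)
  have hx2 : 2 ≤ x.length := (le_max_right _ _).trans hN
  have hx0 : (0 : ℝ) < x.length := by exact_mod_cast (by omega)
  refine ⟨x.length, (le_max_left _ _).trans hN,
    mul_pos hx0 (Real.logb_pos one_lt_two (by exact_mod_cast hx2)), ?_⟩
  have h4 : S.card * (L + 1) ≤ t x.length :=
    (Finset.card_nsmul_le_sum S _ _ h3).trans
      ((sum_length_crossingSeq_le hC.isChain S).trans (ht.tail_length_le hC))
  have h5 : x.length * (L + 1) ≤ 2 * t x.length := by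
    calc x.length * (L + 1) ≤ 2 * S.card * (L + 1) := Nat.mul_le_mul_right _ h2
      _ ≤ _ := by rw [mul_assoc]; omega
  have h6 : (x.length : ℝ) * (L + 1 : ℕ) ≤ 2 * t x.length := by exact_mod_cast h5
  calc (x.length : ℝ) * Real.logb 2 x.length ≤ x.length * (D * (L + 1 : ℕ)) := by gcongr
    _ = D * (x.length * (L + 1 : ℕ)) := by ring
    _ ≤ D * (2 * t x.length) := by gcongr
    _ = D * 2 * t x.length := by ring

theorem WorksInTime.isBigO_of_bounded [Finite Γ] [Finite Q] {c t : ℕ → ℕ} (ht : M.WorksInTime t)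
    (hc : M.UsesCrossing c) {K : ℕ} (hK : ∀ n, c n ≤ K) :
    (fun n : ℕ => (t n : ℝ)) =O[atTop] (fun n : ℕ => (n : ℝ)) := by
  set s := Nat.card (Q × Option Γ)
  set E := (Nat.card Q + 1) ^ K
  have hcs : ∀ {x C} (b), M.IsAcceptingOn x C → (crossingSeq b C).length ≤ K :=
    fun b hC => (hc.length_le hC b).trans (hK _)
  have main : ∀ n, t n ≤ s * (n * K + E * K + 1) := by
    intro n
    have h1 : M.acceptCost time n ≤ ((s * (n * K + E * K + 1) : ℕ) : ℕ∞) := by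
      refine acceptCost_le fun x C hx hC => ?_
      have hT : ∀ C, M.IsAcceptingOn x C → C.length ≤ t n + 1 := by
        intro C hC
        have := ht.tail_length_le hC
        rw [hx, List.length_tail] at this
        omega
      obtain ⟨B, hB⟩ := exists_pos_lt (C := C)
      have h2 := length_le_of_nodup hC.isChain (nodup_of_length_le hT hC) hB
      have h3 : ∑ b ∈ Finset.range B, (crossingSeq b C).length ≤ n * K + E * K := by
        -- The crossed boundaries beyond the input have pairwise distinct crossing sequences of
        -- length at most `K`, hence number at most `E`, independently of `n`.
        let S := (Finset.range B).filter fun b => n ≤ b ∧ crossingSeq b C ≠ []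
        have hS : S.card ≤ E := by
          refine card_le_pow_of_injOn (f := fun b => crossingSeq b C) ?_ fun b _ => hcs b hC
          intro b hb b' hb' he
          simp only [S, Finset.coe_filter, Set.mem_ofPred_eq] at hb hb'
          rcases lt_trichotomy b b' with hlt | rfl | hlt
          · exact absurd he (crossingSeq_ne_of_length_le hT hC (hx ▸ hb.2.1) hlt hb.2.2)
          · rfl
          · exact absurd he.symm (crossingSeq_ne_of_length_le hT hC (hx ▸ hb'.2.1) hlt hb'.2.2)
        calc ∑ b ∈ Finset.range B, (crossingSeq b C).length
            ≤ ∑ b ∈ Finset.range n ∪ S, (crossingSeq b C).length := by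
              refine Finset.sum_le_sum_of_ne_zero fun b hb hne => ?_
              have : crossingSeq b C ≠ [] := fun h => hne (by simp [h])
              simp only [S, Finset.mem_union, Finset.mem_filter, Finset.mem_range] at hb ⊢
              by_cases hbn : b < n
              · exact .inl hbn
              · exact .inr ⟨hb, by omega, this⟩
          _ ≤ (Finset.range n ∪ S).card • K := Finset.sum_le_card_nsmul _ _ _ fun b _ => hcs b hC
          _ ≤ (n + E) * K := by
              refine Nat.mul_le_mul_right _ ((Finset.card_union_le _ _).trans ?_)
              rw [Finset.card_range]
              omega
          _ = n * K + E * K := add_mul _ _ _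
      have h4 : C.tail.length ≤ s * (n * K + E * K + 1) := by
        rw [List.length_tail]
        exact (Nat.sub_le _ _).trans (h2.trans (Nat.mul_le_mul_left _ (by omega)))
      rw [time]
      exact_mod_cast h4
    rw [ht] at h1
    exact_mod_cast h1
  refine IsBigO.of_bound (s * (K + E * K + 1) : ℕ) ?_
  filter_upwards [eventually_ge_atTop 1] with n hn
  rw [Real.norm_natCast, Real.norm_natCast]
  have : t n ≤ s * (K + E * K + 1) * n := by
    refine (main n).trans ?_
    rw [mul_assoc]
    refine Nat.mul_le_mul_left _ ?_
    have := Nat.mul_le_mul_left (E * K) hn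
    rw [add_mul, add_mul, one_mul, mul_comm n K]
    omega
  exact_mod_cast this

/-- Myhill–Nerode: `F u` collects the crossing sequences at the right end of `u` in accepting
computations on extensions of `u`. If `F u = F u'`, gluing replaces the prefix `u` by `u'`, so the
left quotients agree. Lists of length at most `K` form only finitely many sets. -/
theorem UsesCrossing.isRegular [Finite Q] {c : ℕ → ℕ} (hc : M.UsesCrossing c) {K : ℕ}
    (hK : ∀ n, c n ≤ K) : M.language.IsRegular := by
  let F : List A → Set (List Q) := fun u =>
    {s | ∃ v C, M.IsAcceptingOn (u ++ v) C ∧ crossingSeq (u.length - 1) C = s}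
  have hfin : (Set.range F).Finite := by
    refine (List.finite_length_le Q K).finite_subsets.subset ?_
    rintro _ ⟨u, rfl⟩ s ⟨v, C, hC, rfl⟩
    exact (hc.length_le hC _).trans (hK _)
  have hsub : ∀ u u', u ≠ [] → u' ≠ [] → F u = F u' →
      M.language.leftQuotient u ≤ M.language.leftQuotient u' := by
    rintro u u' hu hu' he v ⟨C, hC⟩
    have hlu := List.length_pos_iff.2 hu
    have hlu' := List.length_pos_iff.2 hu'
    obtain ⟨v', C', hC', hs⟩ : crossingSeq (u.length - 1) C ∈ F u' := he ▸ ⟨v, C, hC, rfl⟩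
    obtain ⟨D, hD, -⟩ := exists_glue (y := u' ++ v) hC' hC hs
      (fun i hi => by
        rw [List.getElem?_append_left (by omega), List.getElem?_append_left (by omega)])
      (fun j => by
        rw [List.getElem?_append_right (by omega), List.getElem?_append_right (by omega)]
        congr 1
        omega)
    exact ⟨D, hD⟩
  refine Language.IsRegular.of_finite_range_leftQuotient ?_
  -- The empty word has no boundary at its right end (`u.length - 1` truncates to `0`), so it is
  -- treated apart. A quotient is encoded by the set of all `F u` with `u` nonempty in its class,
  -- which is injective because one common `F u` already determines the quotient.
  have hne : (M.language.leftQuotient '' {u | u ≠ []}).Finite := by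
    refine Set.Finite.of_finite_image
      (f := fun l => F '' {u | u ≠ [] ∧ M.language.leftQuotient u = l}) ?_ ?_
    · refine hfin.finite_subsets.subset ?_
      rintro _ ⟨_, -, rfl⟩
      exact Set.image_subset_range _ _
    · rintro _ ⟨u, hu, rfl⟩ l - h
      have : F u ∈ F '' {u' | u' ≠ [] ∧ M.language.leftQuotient u' = M.language.leftQuotient u} :=
        ⟨u, ⟨hu, rfl⟩, rfl⟩
      obtain ⟨u', ⟨hu', rfl⟩, he⟩ := h.subset this
      exact le_antisymm (hsub u u' hu hu' he.symm) (hsub u' u hu' hu he)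
  refine (hne.insert (M.language.leftQuotient [])).subset ?_
  rintro _ ⟨u, rfl⟩
  by_cases hu : u = []
  · exact .inl (by rw [hu])
  · exact .inr ⟨u, hu, rfl⟩

theorem isBigO_one_iff_bounded {c : ℕ → ℕ} :
    (fun n : ℕ => (c n : ℝ)) =O[atTop] (fun _ : ℕ => (1 : ℝ)) ↔ ∃ K, ∀ n, c n ≤ K := by
  rw [isBigO_one_nat_atTop_iff]
  constructor
  · rintro ⟨K, hK⟩
    refine ⟨⌊K⌋₊, fun n => Nat.le_floor ?_⟩
    simpa using hK n
  · rintro ⟨K, hK⟩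
    exact ⟨K, fun n => by simpa using hK n⟩

theorem isLittleO_mul_logb :
    (fun n : ℕ => (n : ℝ)) =o[atTop] (fun n : ℕ => (n : ℝ) * Real.logb 2 (n : ℝ)) := by
  have h : (fun _ : ℕ => (1 : ℝ)) =o[atTop] fun n : ℕ => Real.logb 2 (n : ℝ) :=
    isLittleO_const_left.2 (.inr (tendsto_norm_atTop_atTop.comp
      ((Real.tendsto_logb_atTop one_lt_two).comp tendsto_natCast_atTop_atTop)))
  simpa using (isBigO_refl (fun n : ℕ => (n : ℝ)) atTop).mul_isLittleO h

end Resources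

end OffLineTM

theorem theorem3 {A Γ Q : Type*} [Finite A] [Finite Γ] [Finite Q] (M : OffLineTM A Γ Q)
    (c t : ℕ → ℕ) :
    (M.UsesCrossing c →
      (fun n : ℕ => (c n : ℝ)) =o[atTop] (fun n : ℕ => Real.logb 2 (n : ℝ)) →
      (fun n : ℕ => (c n : ℝ)) =O[atTop] (fun _ : ℕ => (1 : ℝ))) ∧
    (M.WorksInTime t →
      (fun n : ℕ => (t n : ℝ)) =o[atTop] (fun n : ℕ => (n : ℝ) * Real.logb 2 (n : ℝ)) →
      (fun n : ℕ => (t n : ℝ)) =O[atTop] (fun n : ℕ => (n : ℝ))) ∧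
    (M.UsesCrossing c → M.WorksInTime t →
      ((fun n : ℕ => (c n : ℝ)) =O[atTop] (fun _ : ℕ => (1 : ℝ)) ↔
        (fun n : ℕ => (t n : ℝ)) =O[atTop] (fun n : ℕ => (n : ℝ)))) ∧
    (M.UsesCrossing c →
      (fun n : ℕ => (c n : ℝ)) =O[atTop] (fun _ : ℕ => (1 : ℝ)) → M.language.IsRegular) ∧
    (M.WorksInTime t →
      (fun n : ℕ => (t n : ℝ)) =O[atTop] (fun n : ℕ => (n : ℝ)) → M.language.IsRegular) := by
  refine ⟨fun hc h => ?_, fun ht h => ?_, fun hc ht => ⟨fun h => ?_, fun h => ?_⟩, fun hc h => ?_,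
    fun ht h => ?_⟩
  · exact OffLineTM.isBigO_one_iff_bounded.2 (hc.bounded_of_isLittleO h)
  · obtain ⟨c', hc'⟩ := ht.exists_usesCrossing
    obtain ⟨K, hK⟩ := hc'.bounded_of_worksInTime ht h
    exact ht.isBigO_of_bounded hc' hK
  · obtain ⟨K, hK⟩ := OffLineTM.isBigO_one_iff_bounded.1 h
    exact ht.isBigO_of_bounded hc hK
  · exact OffLineTM.isBigO_one_iff_bounded.2
      (hc.bounded_of_worksInTime ht (h.trans_isLittleO OffLineTM.isLittleO_mul_logb))
  · obtain ⟨K, hK⟩ := OffLineTM.isBigO_one_iff_bounded.1 h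
    exact hc.isRegular hK
  · obtain ⟨c', hc'⟩ := ht.exists_usesCrossing
    obtain ⟨K, hK⟩ :=
      hc'.bounded_of_worksInTime ht (h.trans_isLittleO OffLineTM.isLittleO_mul_logb)
    exact hc'.isRegular hK
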